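/- Let $H$ be Hall's universal locally finite group, that is, the group (unique up to isomorphism) such that: $H$ is countable; $H$ is locally finite (every finitely generated subgroup of $H$ is finite); every finite group embeds into $H$; and any two isomorphic finite subgroups of $H$ are conjugate in $H$. Then: (1) the symmetric group $\mathrm{Sym}(\omega)$ of all permutations of a countably infinite set embeds, as a group, into $\mathrm{Aut}(H)$; (2) there is an infinite set $S \subseteq H$ such that every permutation $\sigma$ of $S$ lifts to an automorphism of $H$, i.e. there is $f \in \mathrm{Aut}(H)$ with $f(s) = \sigma(s)$ for all $s \in S$. -/

import Mathlib

universe u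

/-- A group is locally finite if each of its finitely generated subgroups is finite. -/
def IsLocallyFiniteGroup (G : Type u) [Group G] : Prop :=
  ∀ K : Subgroup G, K.FG → Finite K

/-- `H` is (a copy of) Hall's universal locally finite group: a countable, locally finite group
that embeds every finite group and in which any two isomorphic finite subgroups are conjugate.
(Finite groups are taken in `Type`; up to isomorphism these are all finite groups.) -/
structure IsHallUniversalGroup (H : Type u) [Group H] : Prop where
  countable : Countable H
  locallyFinite : IsLocallyFiniteGroup H
  embeds_finite : ∀ (K : Type) [Group K] [Finite K], ∃ f : K →* H, Function.Injective f
  conj_of_iso : ∀ A B : Subgroup H, Finite A → Finite B → Nonempty (A ≃* B) →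
    ∃ h : H, A.map (MulAut.conj h).toMonoidHom = B

/-! Every countable locally finite group G embeds in a group with the defining properties of H in a
way that is functorial for automorphisms of G, provided every finite group embeds in G. Applied to
the finitary permutations of `ℕ × Bool`, on which Sym(ℕ) acts by conjugation, this gives an action
of Sym(ℕ) on H that permutes the images of the transpositions `fiberSwap n` as it permutes ℕ. These
images form the set S, and they show that the action is faithful.

Classically, embeddings f, g of a finite group K in G become conjugate in Sym(G), since G is a free
right K-set in two isomorphic ways. Choosing the conjugating permutation destroys functoriality, so
all choices are made at once: G acts on `Intertwiners G × G`, where the first factor is the set of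
all systems of choices, and Aut(G) acts on that set too. Requiring permutations to stay inside
cosets of finite subgroups keeps the extension locally finite
(`isLocallyFiniteGroup_hallExtension`), and `exists_conj_hallExtension` gives the conjugacy. The
union of the iterated extensions is homogeneous, and a back-and-forth argument
(`IsConjHomogeneous.nonempty_mulEquiv`) identifies it with H. -/

open Equiv

universe v

/-! ### Countability and local finiteness of permutation groups -/

theorem Subgroup.countable_closure_of_countable {G : Type*} [Group G] {S : Set G}
    (hS : S.Countable) : Countable (Subgroup.closure S) := by
  have := hS.to_subtype
  have : Countable (FreeGroup S) := inferInstanceAs (Countable (Quot _))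
  rw [FreeGroup.closure_eq_range]
  exact (MonoidHom.rangeRestrict_surjective _).countable

/-- A finitely generated group acting faithfully with orbits of bounded size is finite. -/
theorem Group.finite_of_ncard_orbit_le {D Y : Type*} [Group D] [Group.FG D] [MulAction D Y]
    [FaithfulSMul D Y] (n : ℕ) (hfin : ∀ y : Y, (MulAction.orbit D y).Finite)
    (hn : ∀ y : Y, (MulAction.orbit D y).ncard ≤ n) : Finite D := by
  obtain ⟨S, hS⟩ := (Group.fg_def (G := D)).1 inferInstance
  -- Only finitely many homomorphisms D → Sym(n) exist, and they separate D because the actions on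
  -- single orbits are among them, up to numbering.
  have : Finite (D →* Perm (Fin n)) :=
    Finite.of_injective (fun f (s : S) ↦ f s) fun f g h ↦
      MonoidHom.eq_of_eqOn_dense hS fun s hs ↦ congrFun h ⟨s, hs⟩
  have key : ∀ d : D, (∀ f : D →* Perm (Fin n), f d = 1) → d = 1 := by
    intro d hd
    refine FaithfulSMul.eq_of_smul_eq_smul (α := Y) fun y ↦ ?_
    have := (hfin y).to_subtype
    obtain ⟨ι⟩ : Nonempty (MulAction.orbit D y ↪ Fin n) := by
      have e := Finite.equivFin (MulAction.orbit D y)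
      exact ⟨e.toEmbedding.trans (Fin.castLEEmb (by simpa using hn y))⟩
    have h1 := hd ((Perm.viaEmbeddingHom ι).comp (MulAction.toPermHom D (MulAction.orbit D y)))
    have h2 : MulAction.toPermHom D (MulAction.orbit D y) d = 1 :=
      Perm.viaEmbeddingHom_injective ι (by simpa using h1)
    have h3 := congrArg Subtype.val (Equiv.congr_fun h2 ⟨y, MulAction.mem_orbit_self y⟩)
    simpa using h3
  refine Finite.of_injective (fun d (f : D →* Perm (Fin n)) ↦ f d) fun a b hab ↦ ?_
  have := key (a * b⁻¹) fun f ↦ by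
    have : f a = f b := congrFun hab f
    simp [this]
  exact mul_inv_eq_one.1 this

/-- The permutations that map every element to an equivalent one. -/
def Setoid.permSubgroup {Y : Type*} (r : Setoid Y) : Subgroup (Perm Y) where
  carrier := {π | ∀ y, r y (π y)}
  one_mem' y := r.refl y
  mul_mem' {a b} ha hb y := r.trans (hb y) (ha (b y))
  inv_mem' {a} ha y := by
    have : r (a⁻¹ y) y := by simpa using ha (a⁻¹ y)
    exact r.symm this

theorem Setoid.permSubgroup_mono {Y : Type*} {r s : Setoid Y} (h : r ≤ s) :
    r.permSubgroup ≤ s.permSubgroup := fun _ hπ y ↦ h (hπ y)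

theorem Setoid.finite_of_le_permSubgroup {Y : Type*} (r : Setoid Y) (n : ℕ)
    (hfin : ∀ y, {z | r y z}.Finite) (hn : ∀ y, {z | r y z}.ncard ≤ n)
    (D : Subgroup (Perm Y)) (hD : D.FG) (hr : D ≤ r.permSubgroup) : Finite D := by
  have : Group.FG D := (Group.fg_iff_subgroup_fg D).2 hD
  have hsub : ∀ y, MulAction.orbit D y ⊆ {z | r y z} := by
    rintro y _ ⟨d, rfl⟩
    exact hr d.2 y
  exact Group.finite_of_ncard_orbit_le n (fun y ↦ (hfin y).subset (hsub y))
    fun y ↦ (Set.ncard_le_ncard (hsub y) (hfin y)).trans (hn y)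

/-- By directedness finitely many elements preserve the blocks of a single partition; its blocks
have bounded size, so they generate a finite group. -/
theorem isLocallyFiniteGroup_of_directed_setoid {Y ι : Type*} [Nonempty ι] (r : ι → Setoid Y)
    (hdir : Directed (· ≤ ·) r) (hfin : ∀ i y, {z | r i y z}.Finite)
    (hn : ∀ i, ∃ n, ∀ y, {z | r i y z}.ncard ≤ n) (D : Subgroup (Perm Y))
    (hD : ∀ π ∈ D, ∃ i, π ∈ (r i).permSubgroup) : IsLocallyFiniteGroup D := by
  intro K hK
  obtain ⟨S, rfl⟩ := hK
  have hS : ∃ i, ∀ s ∈ S, (s : Perm Y) ∈ (r i).permSubgroup := by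
    classical
    induction S using Finset.induction_on with
    | empty => exact ⟨Classical.arbitrary ι, by simp⟩
    | insert a S _ ih =>
      obtain ⟨i, hi⟩ := ih
      obtain ⟨j, hj⟩ := hD a a.2
      obtain ⟨k, hik, hjk⟩ := hdir i j
      refine ⟨k, fun s hs ↦ ?_⟩
      rcases Finset.mem_insert.1 hs with rfl | hs
      · exact Setoid.permSubgroup_mono hjk hj
      · exact Setoid.permSubgroup_mono hik (hi s hs)
  obtain ⟨i, hi⟩ := hS
  obtain ⟨n, hn⟩ := hn i
  have hfg : (Subgroup.map D.subtype (Subgroup.closure (S : Set D))).FG := by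
    rw [MonoidHom.map_closure, Subgroup.fg_iff]
    exact ⟨_, rfl, S.finite_toSet.image _⟩
  have := (r i).finite_of_le_permSubgroup n (hfin i) hn _ hfg (by
    rw [MonoidHom.map_closure, Subgroup.closure_le]
    rintro _ ⟨s, hs, rfl⟩
    exact hi s hs)
  exact Finite.of_equiv _
    ((Subgroup.closure (S : Set D)).equivMapOfInjective _ D.subtype_injective).symm.toEquiv

/-! ### Permutations intertwining two embeddings of a finite group -/

/-- A group decomposed into the left cosets of the range of an injective homomorphism. -/
theorem MonoidHom.bijective_quotient_out_mul {K G : Type*} [Group K] [Group G] {f : K →* G}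
    (hf : Function.Injective f) :
    Function.Bijective fun p : (G ⧸ f.range) × K ↦ p.1.out * f p.2 := by
  constructor
  · rintro ⟨q, k⟩ ⟨q', k'⟩ h
    have h1 : ∀ (q : G ⧸ f.range) (k : K), ((q.out * f k : G) : G ⧸ f.range) = q := fun q k ↦ by
      rw [QuotientGroup.mk_mul_of_mem _ (MonoidHom.mem_range.2 ⟨k, rfl⟩), QuotientGroup.out_eq']
    have hq : q = q' := by
      rw [← h1 q k, ← h1 q' k']
      exact congrArg _ h
    subst hq
    simpa using hf (mul_left_cancel h)
  · intro g
    obtain ⟨⟨_, k, rfl⟩, hk⟩ := QuotientGroup.mk_out_eq_mul f.range g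
    refine ⟨(g, k⁻¹), ?_⟩
    simp [hk]

/-- Through f and through g, C is a free right K-set with |C| / |K| orbits, so the two K-sets are
isomorphic. -/
theorem exists_perm_mul_eq_of_finite {K C : Type*} [Group K] [Group C] [Finite C] {f g : K →* C}
    (hf : Function.Injective f) (hg : Function.Injective g) :
    ∃ π : Perm C, ∀ c k, π (c * f k) = π c * g k := by
  have aux : ∀ f : K →* C, Function.Injective f →
      ∃ e : Fin (Nat.card C / Nat.card K) × K ≃ C, ∀ i l k, e (i, l * k) = e (i, l) * f k := by
    intro f hf
    have hcard : Nat.card (C ⧸ f.range) = Nat.card C / Nat.card K := by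
      rw [Subgroup.card_eq_card_quotient_mul_card_subgroup f.range,
        ← Nat.card_congr (MonoidHom.ofInjective hf).toEquiv, Nat.mul_div_cancel]
      have := Finite.of_injective f hf
      exact Nat.card_pos
    refine ⟨((Finite.equivFinOfCardEq hcard).symm.prodCongr (Equiv.refl K)).trans
      (Equiv.ofBijective _ (MonoidHom.bijective_quotient_out_mul hf)), fun i l k ↦ ?_⟩
    simp [mul_assoc]
  obtain ⟨e, he⟩ := aux f hf
  obtain ⟨e', he'⟩ := aux g hg
  refine ⟨e.symm.trans e', fun c k ↦ ?_⟩
  obtain ⟨⟨i, l⟩, rfl⟩ := e.surjective c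
  simp [← he, ← he']

/-- The permutation of C from the finite case is copied to every left coset of C along a system of
representatives. -/
theorem Subgroup.exists_perm_mul_eq {K G : Type*} [Group K] [Group G] (C : Subgroup G) [Finite C]
    {f g : K →* G} (hf : Function.Injective f) (hg : Function.Injective g)
    (hfC : ∀ k, f k ∈ C) (hgC : ∀ k, g k ∈ C) :
    ∃ π : Perm G, (∀ x, x⁻¹ * π x ∈ C) ∧ ∀ x k, π (x * f k) = π x * g k := by
  obtain ⟨π, hπ⟩ := exists_perm_mul_eq_of_finite (f := f.codRestrict C hfC)
    (g := g.codRestrict C hgC) (fun a b h ↦ hf (congrArg Subtype.val h))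
    fun a b h ↦ hg (congrArg Subtype.val h)
  let e := Equiv.ofBijective _ (MonoidHom.bijective_quotient_out_mul C.subtype_injective)
  have he : ∀ q (c : C), e (q, c) = q.out * c := fun q c ↦ rfl
  refine ⟨e.symm.trans (((Equiv.refl _).prodCongr π).trans e), fun x ↦ ?_, fun x k ↦ ?_⟩
  · obtain ⟨⟨q, c⟩, rfl⟩ := e.surjective x
    simp only [Equiv.trans_apply, Equiv.symm_apply_apply, Equiv.prodCongr_apply, Prod.map_apply]
    simpa [he, mul_assoc] using C.mul_mem (C.inv_mem c.2) (π c).2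
  · obtain ⟨⟨q, c⟩, rfl⟩ := e.surjective x
    have h : e (q, c) * f k = e (q, c * f.codRestrict C hfC k) := by simp [he, mul_assoc]
    rw [h]
    simp only [Equiv.trans_apply, Equiv.symm_apply_apply, Equiv.prodCongr_apply, Prod.map_apply, hπ]
    simp [he, mul_assoc]

/-! ### The functorial extension in which finite subgroups become conjugate -/

section HallExtension

variable {G : Type*} [Group G]

/-- `π` moves points inside left cosets of the group generated by the entries of `Γ` and
intertwines right multiplication by `a` with right multiplication by `b` for `(a, b) ∈ Γ`. -/
def Intertwines (Γ : Set (G × G)) (π : Perm G) : Prop :=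
  (∀ x, x⁻¹ * π x ∈ Subgroup.closure (Prod.fst '' Γ ∪ Prod.snd '' Γ)) ∧
    ∀ p ∈ Γ, ∀ x, π (x * p.1) = π x * p.2

theorem Intertwines.conj {Γ : Set (G × G)} {π : Perm G} (α : MulAut G)
    (h : Intertwines (Prod.map α α ⁻¹' Γ) π) :
    Intertwines Γ (MulAut.toPerm G α * π * (MulAut.toPerm G α)⁻¹) := by
  have hα : ∀ y, (MulAut.toPerm G α * π * (MulAut.toPerm G α)⁻¹) (α y) = α (π y) := fun y ↦
    congrArg (fun z ↦ α (π z)) (α.symm_apply_apply y)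
  refine ⟨fun x ↦ ?_, fun ⟨a, b⟩ hp x ↦ ?_⟩
  · obtain ⟨x, rfl⟩ := α.surjective x
    have h1 := Subgroup.mem_map_of_mem (α : G →* G) (h.1 x)
    rw [MonoidHom.map_closure] at h1
    rw [hα]
    refine Subgroup.closure_mono ?_ (by
      rw [← map_inv, ← map_mul]
      exact h1)
    rintro _ ⟨_, ⟨p, hp, rfl⟩ | ⟨p, hp, rfl⟩, rfl⟩
    · exact Or.inl ⟨_, hp, rfl⟩
    · exact Or.inr ⟨_, hp, rfl⟩
  · obtain ⟨x, rfl⟩ := α.surjective x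
    obtain ⟨a, rfl⟩ := α.surjective a
    obtain ⟨b, rfl⟩ := α.surjective b
    rw [← map_mul, hα, hα, h.2 (a, b) hp x, map_mul]

theorem preimage_prodMap_inv_preimage (α : MulAut G) (Γ : Set (G × G)) :
    Prod.map ⇑(α⁻¹) ⇑(α⁻¹) ⁻¹' (Prod.map α α ⁻¹' Γ) = Γ := by
  ext p
  change (α (α⁻¹ p.1), α (α⁻¹ p.2)) ∈ Γ ↔ p ∈ Γ
  simp

variable (G) in
/-- Choices of an intertwining permutation for each relation that admits one. -/
def Intertwiners : Type _ :=
  {ρ : Set (G × G) → Perm G // ∀ Γ, (∃ π, Intertwines Γ π) → Intertwines Γ (ρ Γ)}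

instance : Nonempty (Intertwiners G) := by
  classical
  exact ⟨⟨fun Γ ↦ if h : ∃ π, Intertwines Γ π then h.choose else 1, fun Γ h ↦ by
    simpa [h] using h.choose_spec⟩⟩

theorem exists_intertwines_preimage {Γ : Set (G × G)} (α : MulAut G)
    (h : ∃ π, Intertwines Γ π) : ∃ π, Intertwines (Prod.map α α ⁻¹' Γ) π := by
  obtain ⟨π, hπ⟩ := h
  refine ⟨_, Intertwines.conj α⁻¹ (π := π) ?_⟩
  rwa [preimage_prodMap_inv_preimage]

/-- A single system of choices need not be invariant under Aut(G), but the set of all of them is. -/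
instance : MulAction (MulAut G) (Intertwiners G) where
  smul α ρ := ⟨fun Γ ↦ MulAut.toPerm G α * ρ.1 (Prod.map α α ⁻¹' Γ) * (MulAut.toPerm G α)⁻¹,
    fun _ h ↦ (ρ.2 _ (exists_intertwines_preimage α h)).conj⟩
  one_smul _ := rfl
  mul_smul _ _ _ := rfl

theorem Intertwiners.smul_apply (α : MulAut G) (ρ : Intertwiners G) (Γ : Set (G × G)) (x : G) :
    (α • ρ).1 Γ (α x) = α (ρ.1 (Prod.map α α ⁻¹' Γ) x) := by
  change α (ρ.1 _ (α⁻¹ (α x))) = _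
  simp

/-- `G` acting on `Intertwiners G × G` by right translation of the second factor. -/
def rightTranslation : G →* Perm (Intertwiners G × G) where
  toFun g := (Equiv.refl _).prodCongr (Equiv.mulRight g⁻¹)
  map_one' := by ext p <;> simp
  map_mul' a b := by ext p <;> simp [mul_assoc]

@[simp]
theorem rightTranslation_apply (g : G) (p : Intertwiners G × G) :
    rightTranslation g p = (p.1, p.2 * g⁻¹) := rfl

theorem rightTranslation_injective : Function.Injective (rightTranslation (G := G)) := by
  intro a b h
  simpa using congrArg Prod.snd (Equiv.congr_fun h (Classical.arbitrary _, 1))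

/-- The permutation of `Intertwiners G × G` that applies the chosen intertwiner of `Γ`. -/
def intertwinerPerm (Γ : Set (G × G)) : Perm (Intertwiners G × G) where
  toFun p := (p.1, p.1.1 Γ p.2)
  invFun p := (p.1, (p.1.1 Γ).symm p.2)
  left_inv p := by simp
  right_inv p := by simp

@[simp]
theorem intertwinerPerm_apply (Γ : Set (G × G)) (p : Intertwiners G × G) :
    intertwinerPerm Γ p = (p.1, p.1.1 Γ p.2) := rfl

variable (G) in
/-- The finite relations that admit an intertwiner. -/
def finiteRelations : Set (Set (G × G)) := {Γ | Γ.Finite ∧ ∃ π, Intertwines Γ π}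

variable (G) in
/-- A group containing `G` in which isomorphic finite subgroups of `G` are conjugate, functorial
for automorphisms of `G`. -/
def hallExtension : Subgroup (Perm (Intertwiners G × G)) :=
  Subgroup.closure (Set.range rightTranslation ∪ intertwinerPerm '' finiteRelations G)

instance countable_hallExtension [Countable G] : Countable (hallExtension G) := by
  refine Subgroup.countable_closure_of_countable (.union (Set.countable_range _) (.image ?_ _))
  refine (Set.Countable.ofPred_finite (α := G × G)).mono fun Γ h ↦ h.1

/-- The embedding of `G` in its Hall extension. -/
def toHallExtension : G →* hallExtension G :=
  rightTranslation.codRestrict _ fun g ↦ Subgroup.subset_closure (Or.inl ⟨g, rfl⟩)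

theorem toHallExtension_injective : Function.Injective (toHallExtension (G := G)) :=
  fun _ _ h ↦ rightTranslation_injective (congrArg Subtype.val h)

/-- The conjugating element is the intertwiner of Γ = {(f k, g k)}, a relation that admits one by
`Subgroup.exists_perm_mul_eq`. -/
theorem exists_conj_hallExtension (hG : IsLocallyFiniteGroup G) {K : Type*} [Group K] [Finite K]
    {f g : K →* G} (hf : Function.Injective f) (hg : Function.Injective g) :
    ∃ t : hallExtension G, ∀ k, t * toHallExtension (f k) * t⁻¹ = toHallExtension (g k) := by
  let Γ : Set (G × G) := Set.range fun k ↦ (f k, g k)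
  have hΓ : Γ.Finite := Set.finite_range _
  have : Finite (Subgroup.closure (Prod.fst '' Γ ∪ Prod.snd '' Γ)) :=
    hG _ ((Subgroup.fg_iff _).2 ⟨_, rfl, (hΓ.image _).union (hΓ.image _)⟩)
  obtain ⟨π, h1, h2⟩ := Subgroup.exists_perm_mul_eq
    (Subgroup.closure (Prod.fst '' Γ ∪ Prod.snd '' Γ)) hf hg
    (fun k ↦ Subgroup.subset_closure (Or.inl ⟨(f k, g k), ⟨k, rfl⟩, rfl⟩))
    fun k ↦ Subgroup.subset_closure (Or.inr ⟨(f k, g k), ⟨k, rfl⟩, rfl⟩)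
  have hex : ∃ π, Intertwines Γ π := ⟨π, h1, by rintro _ ⟨k, rfl⟩ x; exact h2 x k⟩
  refine ⟨⟨intertwinerPerm Γ, Subgroup.subset_closure (Or.inr ⟨Γ, ⟨hΓ, hex⟩, rfl⟩)⟩, fun k ↦ ?_⟩
  rw [mul_inv_eq_iff_eq_mul]
  refine Subtype.ext (Equiv.ext fun p ↦ Prod.ext rfl ?_)
  have := (p.1.2 Γ hex).2 _ ⟨k⁻¹, rfl⟩ p.2
  change p.1.1 Γ (p.2 * (f k)⁻¹) = p.1.1 Γ p.2 * (g k)⁻¹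
  simpa using this

/-- The partition of `Intertwiners G × G` given by the left cosets of a subgroup. -/
def cosetSetoid (C : Subgroup G) : Setoid (Intertwiners G × G) where
  r p q := p.1 = q.1 ∧ p.2⁻¹ * q.2 ∈ C
  iseqv := ⟨fun p ↦ ⟨rfl, by simp⟩, fun h ↦ ⟨h.1.symm, by simpa using C.inv_mem h.2⟩,
    fun h h' ↦ ⟨h.1.trans h'.1, by simpa [mul_assoc] using C.mul_mem h.2 h'.2⟩⟩

theorem cosetSetoid_mono {C D : Subgroup G} (h : C ≤ D) : cosetSetoid C ≤ cosetSetoid D :=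
  fun _ _ hp ↦ ⟨hp.1, h hp.2⟩

theorem setOf_cosetSetoid (C : Subgroup G) (p : Intertwiners G × G) :
    {q | cosetSetoid C p q} = (fun c ↦ (p.1, p.2 * c)) '' (C : Set G) := by
  ext q
  constructor
  · rintro ⟨h, h'⟩
    exact ⟨_, h', Prod.ext h (by simp)⟩
  · rintro ⟨c, hc, rfl⟩
    exact ⟨rfl, by simpa using hc⟩

theorem IsLocallyFiniteGroup.finite_sup (hG : IsLocallyFiniteGroup G) {C D : Subgroup G}
    (hC : Finite C) (hD : Finite D) : Finite (C ⊔ D : Subgroup G) := by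
  apply hG
  rw [← Subgroup.closure_eq C, ← Subgroup.closure_eq D, ← Subgroup.closure_union, Subgroup.fg_iff]
  exact ⟨_, rfl, Set.Finite.union (Set.toFinite _) (Set.toFinite _)⟩

/-- Each generator preserves the left cosets of some finite subgroup C, which are blocks of size at
most |C|; such subgroups are directed under joins. -/
theorem isLocallyFiniteGroup_hallExtension (hG : IsLocallyFiniteGroup G) :
    IsLocallyFiniteGroup (hallExtension G) := by
  have : Nonempty {C : Subgroup G // Finite C} := ⟨⟨⊥, inferInstance⟩⟩
  have hdir : Directed (· ≤ ·) fun C : {C : Subgroup G // Finite C} ↦ cosetSetoid C.1 :=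
    fun C D ↦ ⟨⟨C.1 ⊔ D.1, hG.finite_sup C.2 D.2⟩, cosetSetoid_mono le_sup_left,
      cosetSetoid_mono le_sup_right⟩
  refine isLocallyFiniteGroup_of_directed_setoid _ hdir (fun C p ↦ ?_) (fun C ↦ ?_) _ ?_
  · have := C.2
    rw [setOf_cosetSetoid]
    exact (Set.toFinite (C.1 : Set G)).image _
  · have := C.2
    refine ⟨(C.1 : Set G).ncard, fun p ↦ ?_⟩
    rw [setOf_cosetSetoid]
    exact Set.ncard_image_le (Set.toFinite _)
  · intro π hπ
    induction hπ using Subgroup.closure_induction with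
    | mem π hπ =>
      rcases hπ with ⟨g, rfl⟩ | ⟨Γ, hΓ, rfl⟩
      · refine ⟨⟨Subgroup.closure {g}, hG _ ((Subgroup.fg_iff _).2 ⟨_, rfl, Set.finite_singleton g⟩)⟩,
          fun p ↦ ⟨rfl, ?_⟩⟩
        simp
      · exact ⟨⟨Subgroup.closure (Prod.fst '' Γ ∪ Prod.snd '' Γ), hG _ ((Subgroup.fg_iff _).2
          ⟨_, rfl, (hΓ.1.image _).union (hΓ.1.image _)⟩)⟩, fun p ↦ ⟨rfl, (p.1.2 Γ hΓ.2).1 p.2⟩⟩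
    | one => exact ⟨Classical.arbitrary _, one_mem _⟩
    | mul a b _ _ ha hb =>
      obtain ⟨C, hC⟩ := ha
      obtain ⟨D, hD⟩ := hb
      obtain ⟨E, hCE, hDE⟩ := hdir C D
      exact ⟨E, mul_mem (Setoid.permSubgroup_mono hCE hC) (Setoid.permSubgroup_mono hDE hD)⟩
    | inv a _ ha =>
      obtain ⟨C, hC⟩ := ha
      exact ⟨C, inv_mem hC⟩

theorem toPerm_mul_rightTranslation (α : MulAut G) (g : G) :
    MulAction.toPermHom _ (Intertwiners G × G) α * rightTranslation g *
      (MulAction.toPermHom _ _ α)⁻¹ = rightTranslation (α g) := by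
  rw [mul_inv_eq_iff_eq_mul]
  ext p <;> simp

theorem toPerm_mul_intertwinerPerm (α : MulAut G) (Γ : Set (G × G)) :
    MulAction.toPermHom _ (Intertwiners G × G) α * intertwinerPerm (Prod.map α α ⁻¹' Γ) *
      (MulAction.toPermHom _ _ α)⁻¹ = intertwinerPerm Γ := by
  rw [mul_inv_eq_iff_eq_mul]
  refine Equiv.ext fun p ↦ Prod.ext rfl ?_
  simp [Intertwiners.smul_apply]

/-- Conjugation by α permutes the generators: g goes to α g and Γ to its image under α × α. -/
theorem toPermHom_mul_mem_hallExtension (α : MulAut G) {π : Perm (Intertwiners G × G)}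
    (hπ : π ∈ hallExtension G) : MulAction.toPermHom _ (Intertwiners G × G) α * π *
      (MulAction.toPermHom _ _ α)⁻¹ ∈ hallExtension G := by
  suffices hallExtension G ≤ (hallExtension G).comap
    (MulAut.conj (MulAction.toPermHom _ (Intertwiners G × G) α)).toMonoidHom from this hπ
  rw [hallExtension, Subgroup.closure_le]
  rintro _ (⟨g, rfl⟩ | ⟨Γ, hΓ, rfl⟩)
  · exact Subgroup.subset_closure (Or.inl ⟨_, (toPerm_mul_rightTranslation α g).symm⟩)
  · have h : Prod.map α α ⁻¹' (Prod.map ⇑(α⁻¹) ⇑(α⁻¹) ⁻¹' Γ) = Γ := by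
      simpa using preimage_prodMap_inv_preimage α⁻¹ Γ
    have h1 := toPerm_mul_intertwinerPerm α (Prod.map ⇑(α⁻¹) ⇑(α⁻¹) ⁻¹' Γ)
    rw [h] at h1
    refine Subgroup.subset_closure (Or.inr ⟨_, ⟨?_, ?_⟩, h1.symm⟩)
    · exact hΓ.1.preimage (Function.Injective.prodMap (MulEquiv.injective _)
        (MulEquiv.injective _)).injOn
    · exact exists_intertwines_preimage _ hΓ.2

theorem toPermHom_mem_normalizer_hallExtension (α : MulAut G) :
    MulAction.toPermHom _ (Intertwiners G × G) α ∈
      Subgroup.normalizer (hallExtension G : Set (Perm (Intertwiners G × G))) := by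
  rw [Subgroup.mem_normalizer_iff]
  refine fun π ↦ ⟨toPermHom_mul_mem_hallExtension α, fun h ↦ ?_⟩
  have := toPermHom_mul_mem_hallExtension α⁻¹ h
  rw [map_inv] at this
  convert this using 1
  group

variable (G) in
/-- Automorphisms of `G` extend functorially to the Hall extension. -/
def hallExtensionAut : MulAut G →* MulAut (hallExtension G) :=
  (hallExtension G).normalizerMonoidHom.comp
    ((MulAction.toPermHom (MulAut G) (Intertwiners G × G)).codRestrict _
      toPermHom_mem_normalizer_hallExtension)

theorem hallExtensionAut_toHallExtension (α : MulAut G) (g : G) :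
    hallExtensionAut G α (toHallExtension g) = toHallExtension (α g) :=
  Subtype.ext (toPerm_mul_rightTranslation α g)

end HallExtension

/-! ### Unions of chains of groups -/

section ChainLimit

variable {G : ℕ → Type*} [∀ n, Group (G n)] (f : ∀ n, G n →* G (n + 1))

/-- The composite maps of a sequence of group homomorphisms. -/
def chainMap (m n : ℕ) (h : m ≤ n) : G m →* G n :=
  Nat.leRecOn (C := fun n ↦ G m →* G n) h (fun {k} g ↦ (f k).comp g) (MonoidHom.id _)

theorem chainMap_self (m : ℕ) : chainMap f m m le_rfl = MonoidHom.id _ :=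
  Nat.leRecOn_self _

theorem chainMap_succ {m n : ℕ} (h : m ≤ n) :
    chainMap f m (n + 1) (h.trans n.le_succ) = (f n).comp (chainMap f m n h) :=
  Nat.leRecOn_succ h _

instance : DirectedSystem G (chainMap f · · ·) where
  map_self m x := by rw [chainMap_self]; rfl
  map_map k j i hij hjk x := by
    induction k, hjk using Nat.le_induction with
    | base => rw [chainMap_self]; rfl
    | succ k hjk ih =>
      rw [chainMap_succ f hjk, chainMap_succ f (hij.trans hjk)]
      exact congrArg (f k) ih

theorem chainMap_injective (hf : ∀ n, Function.Injective (f n)) (m n : ℕ) (h : m ≤ n) :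
    Function.Injective (chainMap f m n h) := by
  induction n, h using Nat.le_induction with
  | base => rw [chainMap_self]; exact Function.injective_id
  | succ n h ih => rw [chainMap_succ f h]; exact (hf n).comp ih

/-- The union of a sequence of groups. -/
abbrev ChainLimit : Type _ := DirectLimit G (chainMap f)

namespace ChainLimit

/-- The map from a member of a sequence of groups to the union. -/
def of (n : ℕ) : G n →* ChainLimit f where
  toFun x := ⟦⟨n, x⟩⟧
  map_one' := (DirectLimit.one_def n).symm
  map_mul' x y := (DirectLimit.mul_def n x y).symm

theorem of_map (n : ℕ) (x : G n) : of f (n + 1) (f n x) = of f n x := by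
  have := DirectLimit.mk_apply (f := chainMap f) n (n + 1) x n.le_succ
  rw [chainMap_succ f le_rfl, chainMap_self] at this
  exact this

theorem of_injective (hf : ∀ n, Function.Injective (f n)) (n : ℕ) :
    Function.Injective (of f n) :=
  DirectLimit.mk_injective _ (chainMap_injective f hf) n

theorem range_of_mono : Monotone fun n ↦ (of f n).range := by
  refine monotone_nat_of_le_succ fun n ↦ ?_
  rintro _ ⟨x, rfl⟩
  exact ⟨f n x, of_map f n x⟩

theorem exists_mem_range_of (x : ChainLimit f) : ∃ n, x ∈ (of f n).range := by
  obtain ⟨n, y, rfl⟩ := DirectLimit.exists_eq_mk _ x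
  exact ⟨n, y, rfl⟩

theorem exists_forall_mem_range_of {S : Set (ChainLimit f)} (hS : S.Finite) :
    ∃ n, ∀ x ∈ S, x ∈ (of f n).range := by
  choose n hn using exists_mem_range_of f
  obtain ⟨N, hN⟩ := (hS.image n).bddAbove
  exact ⟨N, fun x hx ↦ range_of_mono f (hN ⟨x, hx, rfl⟩) (hn x)⟩

instance [∀ n, Countable (G n)] : Countable (ChainLimit f) :=
  inferInstanceAs (Countable (Quotient _))

theorem isLocallyFiniteGroup (hf : ∀ n, Function.Injective (f n))
    (hG : ∀ n, IsLocallyFiniteGroup (G n)) :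
    IsLocallyFiniteGroup (ChainLimit f) := by
  intro K hK
  obtain ⟨S, rfl, hS⟩ := (Subgroup.fg_iff K).1 hK
  obtain ⟨n, hn⟩ := exists_forall_mem_range_of f hS
  have hn : S ⊆ Set.range (of f n) := hn
  have hfin := hG n (Subgroup.closure (of f n ⁻¹' S)) ((Subgroup.fg_iff _).2
    ⟨_, rfl, hS.preimage (of_injective f hf n).injOn⟩)
  rw [← Set.image_preimage_eq_of_subset hn, ← MonoidHom.map_closure]
  exact Finite.of_surjective _
    ((of f n).subgroupMap_surjective (Subgroup.closure (of f n ⁻¹' S)))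

/-- Both finite images lie in a common stage n, and stage n + 1 contains the conjugator. -/
theorem exists_conj (hf : ∀ n, Function.Injective (f n))
    (hconj : ∀ n (A : Type) [Group A] [Finite A] (g h : A →* G n), Function.Injective g →
      Function.Injective h → ∃ t, ∀ a, t * f n (g a) * t⁻¹ = f n (h a))
    {A : Type} [Group A] [Finite A] {g h : A →* ChainLimit f} (hg : Function.Injective g)
    (hh : Function.Injective h) : ∃ t, ∀ a, t * g a * t⁻¹ = h a := by
  obtain ⟨n, hn⟩ := exists_forall_mem_range_of f
    ((Set.finite_range g).union (Set.finite_range h))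
  have lift : ∀ g : A →* ChainLimit f, (∀ a, g a ∈ (of f n).range) →
      ∃ g' : A →* G n, ∀ a, of f n (g' a) = g a := fun g hg ↦
    ⟨(MonoidHom.ofInjective (of_injective f hf n)).symm.toMonoidHom.comp (g.codRestrict _ hg),
      fun a ↦ MonoidHom.apply_ofInjective_symm (of_injective f hf n) ⟨g a, hg a⟩⟩
  obtain ⟨g', hg'⟩ := lift g fun a ↦ hn _ (Or.inl ⟨a, rfl⟩)
  obtain ⟨h', hh'⟩ := lift h fun a ↦ hn _ (Or.inr ⟨a, rfl⟩)
  obtain ⟨t, ht⟩ := hconj n A g' h' (fun a b hab ↦ hg (by rw [← hg', hab, hg']))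
    fun a b hab ↦ hh (by rw [← hh', hab, hh'])
  refine ⟨of f (n + 1) t, fun a ↦ ?_⟩
  rw [← hg', ← hh', ← of_map f n, ← of_map f n, ← ht a, map_mul, map_mul, map_inv]

variable {P : Type*} [Group P] (φ : ∀ n, P →* MulAut (G n))

theorem chainMap_aut (hφ : ∀ n p x, f n (φ n p x) = φ (n + 1) p (f n x)) (p : P) (m n : ℕ) (h : m ≤ n) (x : G m) :
    chainMap f m n h (φ m p x) = φ n p (chainMap f m n h x) := by
  induction n, h using Nat.le_induction with
  | base => rw [chainMap_self]; rfl
  | succ n h ih =>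
    rw [chainMap_succ f h]
    exact (congrArg (f n) ih).trans (hφ n p _)

theorem exists_aut (hφ : ∀ n p x, f n (φ n p x) = φ (n + 1) p (f n x)) :
    ∃ Φ : P →* MulAut (ChainLimit f), ∀ p n x, Φ p (of f n x) = of f n (φ n p x) := by
  let act (p : P) : ChainLimit f → ChainLimit f :=
    DirectLimit.map _ _ (fun n ↦ φ n p) (fun m n h x ↦ chainMap_aut f φ hφ p m n h x)
  have hact : ∀ p n x, act p (of f n x) = of f n (φ n p x) := fun p n x ↦ rfl
  let inst : MulDistribMulAction P (ChainLimit f) :=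
    { smul := act
      one_smul := DirectLimit.induction _ fun n x ↦ (hact 1 n x).trans (by rw [map_one]; rfl)
      mul_smul := fun p q ↦ DirectLimit.induction _ fun n x ↦
        (hact (p * q) n x).trans (by rw [map_mul]; rfl)
      smul_one := fun p ↦ by
        change act p 1 = 1
        rw [← map_one (of f 0), hact, map_one]
      smul_mul := fun p ↦ DirectLimit.induction₂ _ fun n x y ↦ by
        change act p (of f n x * of f n y) = act p (of f n x) * act p (of f n y)
        rw [← map_mul, hact, hact, hact, map_mul, map_mul] }
  exact ⟨MulDistribMulAction.toMulAut P (ChainLimit f), hact⟩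

end ChainLimit
end ChainLimit

/-! ### Iterating the extension equivariantly -/

/-- A countable locally finite group on which `P` acts. -/
structure LocallyFiniteAction (P : Type*) [Group P] where
  carrier : Type
  [group : Group carrier]
  [countable : Countable carrier]
  locallyFinite : IsLocallyFiniteGroup carrier
  action : P →* MulAut carrier

namespace LocallyFiniteAction

variable {P : Type*} [Group P]

attribute [instance] group countable

/-- The Hall extension with the induced action. -/
def extension (X : LocallyFiniteAction P) : LocallyFiniteAction P where
  carrier := hallExtension X.carrier
  locallyFinite := isLocallyFiniteGroup_hallExtension X.locallyFinite
  action := (hallExtensionAut X.carrier).comp X.action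

/-- The iterated Hall extensions. -/
def iterate (X : LocallyFiniteAction P) : ℕ → LocallyFiniteAction P
  | 0 => X
  | n + 1 => (X.iterate n).extension

/-- The embedding of an iterated Hall extension in the next one. -/
def iterateMap (X : LocallyFiniteAction P) (n : ℕ) :
    (X.iterate n).carrier →* (X.iterate (n + 1)).carrier :=
  toHallExtension

theorem exists_homogeneous (X : LocallyFiniteAction P) :
    ∃ (Y : LocallyFiniteAction P) (ι : X.carrier →* Y.carrier), Function.Injective ι ∧
      (∀ p x, Y.action p (ι x) = ι (X.action p x)) ∧
      ∀ (A : Type) [Group A] [Finite A] (g h : A →* Y.carrier), Function.Injective g →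
        Function.Injective h → ∃ t, ∀ a, t * g a * t⁻¹ = h a := by
  have hinj : ∀ n, Function.Injective (X.iterateMap n) := fun n ↦ toHallExtension_injective
  obtain ⟨Φ, hΦ⟩ := ChainLimit.exists_aut X.iterateMap (fun n ↦ (X.iterate n).action)
    fun n p x ↦ (hallExtensionAut_toHallExtension _ _).symm
  refine ⟨⟨ChainLimit X.iterateMap, ChainLimit.isLocallyFiniteGroup _ hinj
    fun n ↦ (X.iterate n).locallyFinite, Φ⟩, ChainLimit.of X.iterateMap 0,
    ChainLimit.of_injective _ hinj 0, fun p x ↦ hΦ p 0 x, ?_⟩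
  intro A _ _ g h hg hh
  exact ChainLimit.exists_conj _ hinj (fun n A _ _ g h hg hh ↦
    exists_conj_hallExtension (X.iterate n).locallyFinite hg hh) hg hh

end LocallyFiniteAction

/-! ### The initial group: finitary permutations -/

section FinitaryPerm

/-- The group of permutations with finite support. -/
def finitaryPerm (Y : Type*) : Subgroup (Perm Y) where
  carrier := {π | {y | π y ≠ y}.Finite}
  one_mem' := by simp
  mul_mem' {a b} ha hb := (Set.Finite.union ha hb).subset fun y hy ↦ by
    by_contra h
    simp only [Set.mem_union, Set.mem_ofPred_eq, not_or, not_not] at h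
    simp [h.1, h.2] at hy
  inv_mem' {a} ha := by
    refine Set.Finite.subset ha fun y hy h ↦ hy ?_
    rw [Perm.inv_eq_iff_eq]
    exact h.symm

theorem mem_finitaryPerm {Y : Type*} {π : Perm Y} :
    π ∈ finitaryPerm Y ↔ {y | π y ≠ y}.Finite := Iff.rfl

instance {Y : Type*} [Countable Y] : Countable (finitaryPerm Y) := by
  classical
  have h : finitaryPerm Y = Subgroup.closure {π | π.IsSwap} := by
    ext π
    rw [mem_closure_isSwap', mem_finitaryPerm]
    rfl
  rw [h]
  apply Subgroup.countable_closure_of_countable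
  refine (Set.countable_range fun p : Y × Y ↦ Equiv.swap p.1 p.2).mono ?_
  rintro _ ⟨x, y, -, rfl⟩
  exact ⟨(x, y), rfl⟩

theorem isLocallyFiniteGroup_finitaryPerm (Y : Type*) :
    IsLocallyFiniteGroup (finitaryPerm Y) := by
  classical
  -- F is one block and all other blocks are singletons; a finitary permutation preserves these
  -- blocks when F is its support.
  let r (F : Finset Y) : Setoid Y :=
    { r := fun y z ↦ y = z ∨ y ∈ F ∧ z ∈ F
      iseqv := ⟨by simp, by tauto, by rintro x y z (rfl | h) (rfl | h') <;> tauto⟩ }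
  have hsub : ∀ F y, {z | r F y z} ⊆ (insert y F : Finset Y) := by
    rintro F y z (rfl | h)
    · simp
    · simp [h.2]
  refine isLocallyFiniteGroup_of_directed_setoid r ?_ (fun F y ↦ (Finset.finite_toSet _).subset (hsub F y))
    (fun F ↦ ⟨F.card + 1, fun y ↦ ?_⟩) _ fun π hπ ↦ ?_
  · intro F F'
    refine ⟨F ∪ F', ?_, ?_⟩ <;>
    · rintro x y (rfl | h)
      · exact Or.inl rfl
      · exact Or.inr (by simp [h.1, h.2])
  · refine (Set.ncard_le_ncard (hsub F y) (Finset.finite_toSet _)).trans ?_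
    rw [Set.ncard_coe_finset]
    exact Finset.card_insert_le _ _
  · refine ⟨(mem_finitaryPerm.1 hπ).toFinset, fun y ↦ ?_⟩
    by_cases h : π y = y
    · exact Or.inl h.symm
    · exact Or.inr (by simpa using h)

theorem exists_injective_finitaryPerm (K Y : Type*) [Group K] [Finite K] [Infinite Y] :
    ∃ f : K →* finitaryPerm Y, Function.Injective f := by
  obtain ⟨ι⟩ : Nonempty (K ↪ Y) :=
    ⟨(Finite.equivFin K).toEmbedding.trans (Fin.valEmbedding.trans (Infinite.natEmbedding Y))⟩
  refine ⟨((Perm.viaEmbeddingHom ι).comp (MulAction.toPermHom K K)).codRestrict _ fun k ↦ ?_, ?_⟩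
  · refine (Set.finite_range ι).subset fun y hy ↦ ?_
    by_contra h
    exact hy (Perm.viaEmbedding_apply_of_notMem _ _ _ h)
  · intro a b h
    have := Perm.viaEmbeddingHom_injective ι (congrArg Subtype.val h)
    exact MulAction.toPerm_injective this

instance (Y : Type*) : (finitaryPerm Y).Normal where
  conj_mem π hπ τ := by
    refine (Set.Finite.image τ hπ).subset fun y hy ↦ ⟨τ⁻¹ y, fun h ↦ hy ?_, by simp⟩
    simp only [Perm.mul_apply, h]
    simp

/-- Conjugation of finitary permutations of `ℕ × Bool` by permutations of the first factor. -/
def finitaryPermAut : Perm ℕ →* MulAut (finitaryPerm (ℕ × Bool)) :=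
  MulAut.conjNormal.comp
    { toFun := fun σ ↦ σ.prodCongr (Equiv.refl Bool)
      map_one' := rfl
      map_mul' := fun _ _ ↦ rfl }

/-- The transposition of `(n, false)` and `(n, true)`. -/
def fiberSwap (n : ℕ) : finitaryPerm (ℕ × Bool) :=
  ⟨Equiv.swap (n, false) (n, true), (Set.toFinite {(n, false), (n, true)}).subset fun y hy ↦ by
    by_contra h
    simp only [Set.mem_insert_iff, Set.mem_singleton_iff, not_or] at h
    exact hy (Equiv.swap_apply_of_ne_of_ne h.1 h.2)⟩

theorem fiberSwap_injective : Function.Injective fiberSwap := by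
  intro m n h
  have h1 := Equiv.congr_fun (congrArg Subtype.val h) (m, false)
  by_contra hmn
  have h2 : Equiv.swap (m, false) (m, true) (m, false) =
      Equiv.swap (n, false) (n, true) (m, false) := h1
  rw [Equiv.swap_apply_left, Equiv.swap_apply_of_ne_of_ne (by simp [hmn]) (by simp)] at h2
  simp at h2

theorem finitaryPermAut_fiberSwap (σ : Perm ℕ) (n : ℕ) :
    finitaryPermAut σ (fiberSwap n) = fiberSwap (σ n) :=
  Subtype.ext (Equiv.swap_apply_apply (σ.prodCongr (Equiv.refl Bool)) _ _).symm

end FinitaryPerm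

/-! ### Homogeneity and uniqueness by back-and-forth -/

section Uniqueness

/-- Any two embeddings of a finite group in `H` are conjugate. -/
def IsConjHomogeneous (H : Type*) [Group H] : Prop :=
  ∀ (A : Type) [Group A] [Finite A] (g h : A →* H), Function.Injective g →
    Function.Injective h → ∃ t, ∀ a, t * g a * t⁻¹ = h a

/-- Every embedding of A is compared with one embedding `l` that factors through the regular
representation in a copy of Sym(A). Conjugate images give agreement only up to an automorphism α of
A, but α is induced by conjugation in Sym(A), hence in H. -/
theorem IsHallUniversalGroup.isConjHomogeneous {H : Type u} [Group H]
    (hH : IsHallUniversalGroup H) : IsConjHomogeneous H := by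
  intro A _ _ g h hg hh
  obtain ⟨e, he⟩ := hH.embeds_finite (Perm A)
  let l : A →* H := e.comp (MulAction.toPermHom A A)
  have hl : Function.Injective l := he.comp MulAction.toPerm_injective
  have key : ∀ g : A →* H, Function.Injective g → ∃ t, ∀ a, t * g a * t⁻¹ = l a := by
    intro g hg
    obtain ⟨u, hu⟩ := hH.conj_of_iso g.range l.range (Set.finite_range g) (Set.finite_range l)
      ⟨(MonoidHom.ofInjective hg).symm.trans (MonoidHom.ofInjective hl)⟩
    let c : A →* H := (MulAut.conj u).toMonoidHom.comp g
    have hc : Function.Injective c := (MulAut.conj u).injective.comp hg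
    have hcl : c.range = l.range := by rw [← hu, MonoidHom.range_comp]
    let α : A ≃* A := (MonoidHom.ofInjective hc).trans
      ((MulEquiv.subgroupCongr hcl).trans (MonoidHom.ofInjective hl).symm)
    have hα : ∀ a, l (α a) = u * g a * u⁻¹ := fun a ↦
      MonoidHom.apply_ofInjective_symm hl ((MulEquiv.subgroupCongr hcl) (MonoidHom.ofInjective hc a))
    refine ⟨(e α.toEquiv)⁻¹ * u, fun a ↦ ?_⟩
    have hp : (α.toEquiv : Perm A) * MulAction.toPermHom A A a =
        MulAction.toPermHom A A (α a) * α.toEquiv := Equiv.ext fun x ↦ map_mul α a x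
    have hp' : e α.toEquiv * l a = l (α a) * e α.toEquiv := by
      have := congrArg e hp
      rwa [map_mul, map_mul] at this
    calc (e α.toEquiv)⁻¹ * u * g a * ((e α.toEquiv)⁻¹ * u)⁻¹
        = (e α.toEquiv)⁻¹ * (u * g a * u⁻¹) * e α.toEquiv := by group
      _ = l a := by rw [← hα, mul_assoc, ← hp', inv_mul_cancel_left]
  obtain ⟨s, hs⟩ := key g hg
  obtain ⟨t, ht⟩ := key h hh
  refine ⟨t⁻¹ * s, fun a ↦ ?_⟩
  calc t⁻¹ * s * g a * (t⁻¹ * s)⁻¹ = t⁻¹ * (s * g a * s⁻¹) * t := by group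
    _ = h a := by rw [hs, ← ht]; group

/-- Every finite group embeds in `H`. -/
def EmbedsFiniteGroups (H : Type*) [Group H] : Prop :=
  ∀ (K : Type) [Group K] [Finite K], ∃ f : K →* H, Function.Injective f

/-- Any embedding of L restricts to an embedding of A, which some conjugation moves to f. -/
theorem IsConjHomogeneous.exists_extension {H : Type*} [Group H] (hH : IsConjHomogeneous H)
    (hemb : EmbedsFiniteGroups H) {A L : Type*} [Group A] [Group L] [Finite L] {i : A →* L}
    {f : A →* H} (hi : Function.Injective i) (hf : Function.Injective f) :
    ∃ g : L →* H, Function.Injective g ∧ ∀ a, g (i a) = f a := by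
  have := Finite.of_injective i hi
  -- The hypotheses speak of groups in `Type`, hence the small copies.
  obtain ⟨e, he⟩ := hemb (Shrink.{0} L)
  let e' : L →* H := e.comp (equivShrink.{0} L).symm.mulEquiv.symm.toMonoidHom
  have he' : Function.Injective e' := he.comp (MulEquiv.injective _)
  let s : Shrink.{0} A →* A := (equivShrink.{0} A).symm.mulEquiv.toMonoidHom
  have hs : Function.Bijective s := (equivShrink.{0} A).symm.mulEquiv.bijective
  obtain ⟨t, ht⟩ := hH (Shrink.{0} A) ((e'.comp i).comp s) (f.comp s)
    ((he'.comp hi).comp hs.1) (hf.comp hs.1)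
  refine ⟨(MulAut.conj t).toMonoidHom.comp e', (MulAut.conj t).injective.comp he', fun a ↦ ?_⟩
  obtain ⟨a, rfl⟩ := hs.2 a
  exact ht a

variable {H₁ : Type u} {H₂ : Type v} [Group H₁] [Group H₂]

variable (H₁ H₂) in
/-- Isomorphisms between finite subgroups, as subgroups of the product, ordered by extension. -/
abbrev FinitePartialIso : Type (max u v) :=
  {Γ : Subgroup (H₁ × H₂) // Finite Γ ∧ ∀ p ∈ Γ, p.1 = 1 ↔ p.2 = 1}

/-- The inverse of a partial isomorphism. -/
def FinitePartialIso.swap (Γ : FinitePartialIso H₁ H₂) : FinitePartialIso H₂ H₁ :=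
  ⟨Γ.1.map (MulEquiv.prodComm : H₁ × H₂ ≃* H₂ × H₁).toMonoidHom, by
    have := Γ.2.1
    exact Finite.of_surjective _ (MonoidHom.subgroupMap_surjective _ Γ.1), by
    rintro _ ⟨p, hp, rfl⟩
    exact (Γ.2.2 p hp).symm⟩

theorem FinitePartialIso.mem_swap {Γ : FinitePartialIso H₁ H₂} {a : H₁} {b : H₂} :
    (b, a) ∈ Γ.swap.1 ↔ (a, b) ∈ Γ.1 := by
  constructor
  · rintro ⟨p, hp, h⟩
    have h1 : p.2 = b := congrArg Prod.fst h
    have h2 : p.1 = a := congrArg Prod.snd h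
    rw [← h1, ← h2]
    exact hp
  · exact fun h ↦ ⟨_, h, rfl⟩

/-- The second projection of Γ is extended along the first to the finite group L generated by the
domain and a; Δ is the graph of the extension. -/
theorem FinitePartialIso.exists_le_mem_fst (h₁ : IsLocallyFiniteGroup H₁)
    (h₂ : IsConjHomogeneous H₂) (h₂' : EmbedsFiniteGroups H₂) (Γ : FinitePartialIso H₁ H₂)
    (a : H₁) : ∃ Δ, Γ ≤ Δ ∧ ∃ b, (a, b) ∈ Δ.1 := by
  obtain ⟨Γ, hΓ, hΓ'⟩ := Γ
  let L : Subgroup H₁ := Γ.map (MonoidHom.fst H₁ H₂) ⊔ Subgroup.closure {a}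
  have : Finite L := h₁.finite_sup
    (Finite.of_surjective _ (MonoidHom.subgroupMap_surjective _ Γ))
    (h₁ _ ((Subgroup.fg_iff _).2 ⟨_, rfl, Set.finite_singleton a⟩))
  let i : Γ →* L := ((MonoidHom.fst H₁ H₂).comp Γ.subtype).codRestrict L
    fun p ↦ le_sup_left (α := Subgroup H₁) ⟨p, p.2, rfl⟩
  let f : Γ →* H₂ := (MonoidHom.snd H₁ H₂).comp Γ.subtype
  have hi : Function.Injective i := by
    refine (injective_iff_map_eq_one i).2 fun p hp ↦ ?_
    have h1 : (p : H₁ × H₂).1 = 1 := congrArg Subtype.val hp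
    exact Subtype.ext (Prod.ext h1 ((hΓ' p p.2).1 h1))
  have hf : Function.Injective f := by
    refine (injective_iff_map_eq_one f).2 fun p hp ↦ ?_
    have h1 : (p : H₁ × H₂).2 = 1 := hp
    exact Subtype.ext (Prod.ext ((hΓ' p p.2).2 h1) h1)
  obtain ⟨g, hg, hgi⟩ := h₂.exists_extension h₂' hi hf
  refine ⟨⟨(L.subtype.prod g).range, Set.finite_range (L.subtype.prod g), ?_⟩, ?_, ?_⟩
  · rintro _ ⟨x, rfl⟩
    change (x : H₁) = 1 ↔ g x = 1
    rw [map_eq_one_iff g hg, OneMemClass.coe_eq_one]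
  · exact fun p hp ↦ ⟨i ⟨p, hp⟩, Prod.ext rfl (hgi ⟨p, hp⟩)⟩
  · have ha : a ∈ L := le_sup_right (α := Subgroup H₁) (Subgroup.subset_closure rfl)
    exact ⟨g ⟨a, ha⟩, ⟨a, ha⟩, rfl⟩

theorem FinitePartialIso.exists_le_mem_snd (h₂ : IsLocallyFiniteGroup H₂)
    (h₁ : IsConjHomogeneous H₁) (h₁' : EmbedsFiniteGroups H₁) (Γ : FinitePartialIso H₁ H₂)
    (b : H₂) : ∃ Δ, Γ ≤ Δ ∧ ∃ a, (a, b) ∈ Δ.1 := by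
  obtain ⟨Δ, hΔ, a, ha⟩ := Γ.swap.exists_le_mem_fst h₂ h₁ h₁' b
  exact ⟨Δ.swap, fun p hp ↦ mem_swap.2 (hΔ (mem_swap.2 hp)), a, mem_swap.2 ha⟩

/-- A directed family of partial isomorphisms that is total on both sides gives an isomorphism. -/
theorem FinitePartialIso.nonempty_mulEquiv (I : Order.Ideal (FinitePartialIso H₁ H₂))
    (hfst : ∀ a, ∃ Γ ∈ I, ∃ b, (a, b) ∈ Γ.1) (hsnd : ∀ b, ∃ Γ ∈ I, ∃ a, (a, b) ∈ Γ.1) :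
    Nonempty (H₁ ≃* H₂) := by
  have hdir : ∀ p q : H₁ × H₂, (∃ Γ ∈ I, p ∈ Γ.1) → (∃ Γ ∈ I, q ∈ Γ.1) →
      ∃ Γ ∈ I, p ∈ Γ.1 ∧ q ∈ Γ.1 := by
    rintro p q ⟨Γ, hΓ, hp⟩ ⟨Δ, hΔ, hq⟩
    obtain ⟨E, hE, h1, h2⟩ := I.directed Γ hΓ Δ hΔ
    exact ⟨E, hE, h1 hp, h2 hq⟩
  have huniq : ∀ p q : H₁ × H₂, (∃ Γ ∈ I, p ∈ Γ.1) → (∃ Γ ∈ I, q ∈ Γ.1) →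
      (p.1 = q.1 ↔ p.2 = q.2) := by
    intro p q hp hq
    obtain ⟨Γ, -, hp, hq⟩ := hdir p q hp hq
    simpa [div_eq_one] using Γ.2.2 _ (Γ.1.div_mem hp hq)
  choose Γ hΓ F hF using hfst
  have hF' : ∀ a, ∃ Γ ∈ I, (a, F a) ∈ Γ.1 := fun a ↦ ⟨Γ a, hΓ a, hF a⟩
  have hmul : ∀ a b, F (a * b) = F a * F b := by
    intro a b
    obtain ⟨E, hE, ha, hb⟩ := hdir _ _ (hF' a) (hF' b)
    exact (huniq _ _ (hF' (a * b)) ⟨E, hE, E.1.mul_mem ha hb⟩).1 rfl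
  refine ⟨MulEquiv.ofBijective (MonoidHom.mk' F hmul) ⟨fun a b h ↦ ?_, fun b ↦ ?_⟩⟩
  · exact (huniq _ _ (hF' a) (hF' b)).2 h
  · obtain ⟨E, hE, a, ha⟩ := hsnd b
    exact ⟨a, (huniq _ _ (hF' a) ⟨E, hE, ha⟩).1 rfl⟩

/-- Hall's universal group is unique up to isomorphism. -/
theorem IsConjHomogeneous.nonempty_mulEquiv [Countable H₁] [Countable H₂]
    (lf₁ : IsLocallyFiniteGroup H₁) (lf₂ : IsLocallyFiniteGroup H₂) (h₁ : IsConjHomogeneous H₁)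
    (h₂ : IsConjHomogeneous H₂) (emb₁ : EmbedsFiniteGroups H₁) (emb₂ : EmbedsFiniteGroups H₂) :
    Nonempty (H₁ ≃* H₂) := by
  -- There are countably many requirements, one for each element to be put in the domain or the
  -- range, so some ideal meets them all.
  let := Encodable.ofCountable (H₁ ⊕ H₂)
  let D : H₁ ⊕ H₂ → Order.Cofinal (FinitePartialIso H₁ H₂) := Sum.elim
    (fun a ↦ ⟨{Γ | ∃ b, (a, b) ∈ Γ.1}, fun Γ ↦ by
      obtain ⟨Δ, h, h'⟩ := Γ.exists_le_mem_fst lf₁ h₂ emb₂ a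
      exact ⟨Δ, h', h⟩⟩)
    (fun b ↦ ⟨{Γ | ∃ a, (a, b) ∈ Γ.1}, fun Γ ↦ by
      obtain ⟨Δ, h, h'⟩ := Γ.exists_le_mem_snd lf₂ h₁ emb₁ b
      exact ⟨Δ, h', h⟩⟩)
  let Γ₀ : FinitePartialIso H₁ H₂ := ⟨⊥, inferInstance, fun p hp ↦ by
    rw [Subgroup.mem_bot.1 hp]
    simp⟩
  refine FinitePartialIso.nonempty_mulEquiv (Order.idealOfCofinals Γ₀ D) (fun a ↦ ?_) fun b ↦ ?_
  · obtain ⟨Γ, h, h'⟩ := Order.cofinal_meets_idealOfCofinals Γ₀ D (Sum.inl a)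
    exact ⟨Γ, h', h⟩
  · obtain ⟨Γ, h, h'⟩ := Order.cofinal_meets_idealOfCofinals Γ₀ D (Sum.inr b)
    exact ⟨Γ, h', h⟩

end Uniqueness

/-! ### The action of Sym(ℕ) on Hall's group -/

/-- Hall's group contains a sequence of distinct elements on which an action of all permutations
of `ℕ` by automorphisms restricts to the natural one. -/
theorem IsHallUniversalGroup.exists_perm_action {H : Type u} [Group H]
    (hH : IsHallUniversalGroup H) : ∃ (φ : Perm ℕ →* MulAut H) (s : ℕ → H),
      Function.Injective s ∧ ∀ σ n, φ σ (s n) = s (σ n) := by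
  have := hH.countable
  obtain ⟨Y, ι, hι, hact, hY⟩ := LocallyFiniteAction.exists_homogeneous
    (P := Perm ℕ) ⟨finitaryPerm (ℕ × Bool), isLocallyFiniteGroup_finitaryPerm _, finitaryPermAut⟩
  have hemb : EmbedsFiniteGroups Y.carrier := fun K _ _ ↦ by
    obtain ⟨f, hf⟩ := exists_injective_finitaryPerm K (ℕ × Bool)
    exact ⟨ι.comp f, hι.comp hf⟩
  obtain ⟨e⟩ := IsConjHomogeneous.nonempty_mulEquiv Y.locallyFinite hH.locallyFinite hY
    hH.isConjHomogeneous hemb hH.embeds_finite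
  refine ⟨(MulAut.congr e).toMonoidHom.comp Y.action, fun n ↦ e (ι (fiberSwap n)),
    e.injective.comp (hι.comp fiberSwap_injective), fun σ n ↦ ?_⟩
  change e (Y.action σ (e.symm (e (ι (fiberSwap n))))) = _
  rw [e.symm_apply_apply, hact]
  exact congrArg (fun x ↦ e (ι x)) (finitaryPermAut_fiberSwap σ n)

theorem mainTheorem5 (H : Type*) [Group H] (hH : IsHallUniversalGroup H) :
    (∃ φ : Equiv.Perm ℕ →* MulAut H, Function.Injective φ) ∧
    (∃ S : Set H, S.Infinite ∧
      ∀ σ : Equiv.Perm S, ∃ f : MulAut H, ∀ s : S, f (s : H) = (σ s : H)) := by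
  obtain ⟨φ, s, hs, hφ⟩ := hH.exists_perm_action
  refine ⟨⟨φ, fun σ τ h ↦ Equiv.ext fun n ↦ hs ?_⟩, Set.range s, Set.infinite_range_of_injective hs,
    fun σ ↦ ?_⟩
  · rw [← hφ, ← hφ, h]
  · let e := Equiv.ofInjective s hs
    refine ⟨φ (e.trans (σ.trans e.symm)), ?_⟩
    rintro ⟨_, n, rfl⟩
    rw [hφ]
    exact Equiv.apply_ofInjective_symm hs (σ (e n))
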